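/- For a perfect matching $M$ of a finite graph $G$ (a set of pairwise disjoint edges covering every vertex), an anti-forcing set of $M$ is a set $S\subseteq E(G)\setminus M$ such that $M$ is the only perfect matching of $G-S$; the anti-forcing number $af(G,M)$ is the minimum size of an anti-forcing set of $M$, and the anti-forcing polynomial of $G$ is $Af(G,x)=\sum_{M}x^{af(G,M)}$, the sum over all perfect matchings $M$ of $G$. For $n\ge 1$ let $G_n$ be the polyomino graph consisting of $4n$ squares with vertices $u_i,v_i$ $(0\le i\le 2n)$ and $w_i,z_i$ $(1\le i\le 2n)$ and edges $u_iv_i$ $(0\le i\le 2n)$; $u_iu_{i+1}$ and $v_iv_{i+1}$ $(0\le i<2n)$; $u_iw_i$ and $v_iz_i$ $(1\le i\le 2n)$; $w_{2i-1}w_{2i}$ and $z_{2i-1}z_{2i}$ $(1\le i\le n)$. Let $G_0$ be the null graph (no vertices). **Theorem.** For every $n\ge 3$, $$Af(G_n,x)=(3x^3+3x^2+x)\,Af(G_{n-1},x)-(2x^6+6x^5-x^4+3x^3)\,Af(G_{n-2},x)+(x^7+3x^6)\,Af(G_{n-3},x),$$ where $Af(G_0,x)=1$, $Af(G_1,x)=2x^3+3x^2+x$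 and $Af(G_2,x)=4x^6+9x^5+15x^4+3x^3+x^2$. -/

import Mathlib

open Polynomial

section AntiForcing

variable {V : Type*}

/-- A set of edges `M` is a perfect matching of `G`: it is the edge set of a subgraph of `G` that
is a perfect matching in the sense of Mathlib. -/
def IsPerfectMatchingEdges (G : SimpleGraph V) (M : Finset (Sym2 V)) : Prop :=
  ∃ P : G.Subgraph, P.IsPerfectMatching ∧ P.edgeSet = (M : Set (Sym2 V))

/-- `S` is an anti-forcing set of the perfect matching `M` of `G`: it consists of edges of `G`
outside `M`, and `M` is the one and only perfect matching of `G - S`. -/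
def IsAntiForcingSet (G : SimpleGraph V) (M S : Finset (Sym2 V)) : Prop :=
  (S : Set (Sym2 V)) ⊆ G.edgeSet \ (M : Set (Sym2 V)) ∧
    ∀ N : Finset (Sym2 V),
      IsPerfectMatchingEdges (G.deleteEdges (S : Set (Sym2 V))) N ↔ N = M

/-- The anti-forcing number `af(G, M)`: the least size of an anti-forcing set of `M`. -/
noncomputable def antiForcingNumber (G : SimpleGraph V) (M : Finset (Sym2 V)) : ℕ :=
  sInf {k : ℕ | ∃ S : Finset (Sym2 V), IsAntiForcingSet G M S ∧ S.card = k}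

open Classical in
/-- The anti-forcing polynomial `Af(G, x) = ∑ x ^ af(G, M)`, the sum being over all perfect
matchings `M` of the finite graph `G`. -/
noncomputable def antiForcingPolynomial [Fintype V] (G : SimpleGraph V) : ℤ[X] :=
  ∑ M : Finset (Sym2 V) with IsPerfectMatchingEdges G M, X ^ antiForcingNumber G M

end AntiForcing

/-- The vertices of `G_n`. The pair `(i, r)` is the vertex in column `i` (with `0 ≤ i ≤ 2 n`) and
row `r`, where the rows `0, 1, 2, 3` carry `w_i, u_i, v_i, z_i`. Column `0` has only `u_0` and
`v_0`; there are no vertices at all for `n = 0`. -/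
abbrev PolyominoVertex (n : ℕ) : Type :=
  {p : Fin (2 * n + 1) × Fin 4 // 0 < n ∧ (p.1.val = 0 → p.2 = 1 ∨ p.2 = 2)}

/-- The polyomino graph `G_n`, a subgraph of the grid with 4 rows and `2 n + 1` columns.
Vertical edges: `w_i u_i`, `u_i v_i`, `v_i z_i` (in column `0`: only `u_0 v_0`).
Horizontal edges: `u_i u_{i+1}` and `v_i v_{i+1}` for `0 ≤ i < 2 n`, and
`w_i w_{i+1}` and `z_i z_{i+1}` for odd `i < 2 n`. -/
def polyominoGraph (n : ℕ) : SimpleGraph (PolyominoVertex n) :=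
  SimpleGraph.fromRel fun p q =>
    (p.1.1 = q.1.1 ∧ p.1.2.val + 1 = q.1.2.val) ∨
    (p.1.1.val + 1 = q.1.1.val ∧ p.1.2 = q.1.2 ∧
      (p.1.2 = 1 ∨ p.1.2 = 2 ∨ Odd p.1.1.val))

/-! The proof is a transfer-matrix computation. Cut `G_n` into column 0 and `n` blocks joined by
pairs of links. In a perfect matching the two links of a pair are both used or both unused, so each
block shows one of eight tiles and perfect matchings correspond to chains of tiles with agreeing
link states (`exists_chainMatching_eq`, `chainMatching_injective`).

A deletion set splits into its parts in the blocks and possibly the edge `u_0 v_0`. Uniqueness of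
the surviving matching can be checked block by block if one bit is carried along: whether the rest
of the chain must force its own left link state, or may take it as given (`rigid_succ`). Minimising
over this bit gives the recursion `minCut`: the lower bound comes from disjoint differences between
competing tiles (`minCut_le`), and explicit cuts attain it (`exists_rigid`).

Three generating polynomials suffice: chains starting unlinked, with the link state given or to be
forced, and chains starting linked, with it given. They satisfy a 3 × 3 linear system over `ℤ[X]`,
and the asserted recurrence is the Cayley–Hamilton relation of its matrix. -/

/-! ### Tiles and the cost of isolating one inside a block. -/

/-- The ways in which a perfect matching can meet a block of `G_n`, that is, the columns
`2 i + 1` and `2 i + 2` together with the two edges to column `2 i`. The letters say how the block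
is linked to the left and to the right (`f`: not at all, `t`: by two matching edges). -/
inductive Tile
  | ff0 | ff1 | ff2 | ff3 | ff4 | ft | tf | tt
  deriving DecidableEq

namespace Tile

instance : Fintype Tile where
  elems := {ff0, ff1, ff2, ff3, ff4, ft, tf, tt}
  complete := by rintro ⟨⟩ <;> decide

/-- The matching edges of a tile. The edges of a block are numbered `0, 1` (the links to the left
in the rows `u, v`), `2, 3, 4` and `5, 6, 7` (the vertical edges of the two columns) and
`8, 9, 10, 11` (the horizontal edges between them). -/
def support : Tile → Finset (Fin 12)
  | ff0 => {2, 4, 5, 7}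
  | ff1 => {2, 5, 10, 11}
  | ff2 => {3, 6, 8, 11}
  | ff3 => {4, 7, 8, 9}
  | ff4 => {8, 9, 10, 11}
  | ft => {3, 8, 11}
  | tf => {0, 1, 6, 8, 11}
  | tt => {0, 1, 8, 11}

/-- Whether the tile uses the links to the left. -/
def src : Tile → Bool
  | tf | tt => true
  | _ => false

/-- Whether the tile uses the links to the right. -/
def tgt : Tile → Bool
  | ft | tt => true
  | _ => false

/-- Deleting the edges `s` of a block leaves only the tile `m`, among the tiles that agree with `m`
on the left (or any, if `c`) and agree with `m` on the right (or any, unless `q`). -/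
def Isolates (m : Tile) (c q : Bool) (s : Finset (Fin 12)) : Prop :=
  ∀ l : Tile, Disjoint l.support s → (l.src = m.src ∨ c = true) →
    (l.tgt = m.tgt ∨ q = false) → l = m

/-- Tiles whose differences with `m` are pairwise disjoint and have to be met by any set isolating
`m`. -/
def packing : Tile → Bool → Bool → List Tile
  | ff0, _, _ => [ff1, ff3]
  | ff1, _, _ => [ff0, ff4]
  | ff2, false, _ => [ff0, ff4]
  | ff2, true, _ => [ff0, ff4, tf]
  | ff3, _, _ => [ff0, ff4]
  | ff4, true, false => [ff1, ft, ff3, tf]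
  | ff4, _, _ => [ff1, ff2, ff3]
  | ft, false, false => [ff0, ff2, ff4]
  | ft, false, true => []
  | ft, true, false => [ff0, ff2, ff4, tt]
  | ft, true, true => [tt]
  | tf, false, _ => []
  | tf, true, _ => [ff0, ff2, ff4]
  | tt, false, false => [tf]
  | tt, false, true => []
  | tt, true, false => [tf, ft, ff0, ff4]
  | tt, true, true => [ft]

/-- Disjoint sets that all meet `s` pick distinct elements of `s`. Counting only the elements
covered by the list lets the induction insert a new one. -/
theorem length_le_card {α β : Type*} [DecidableEq α] (f : β → Finset α) (s : Finset α) :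
    ∀ L : List β, L.Pairwise (fun a b => Disjoint (f a) (f b)) → (∀ a ∈ L, ¬ Disjoint (f a) s) →
      L.length ≤ (s.filter fun x => ∃ a ∈ L, x ∈ f a).card
  | [], _, _ => Nat.zero_le _
  | a :: L, h, h' => by
    rw [List.pairwise_cons] at h
    have ih := length_le_card f s L h.2 fun b hb => h' b (List.mem_cons_of_mem _ hb)
    obtain ⟨x, hx, hxs⟩ := Finset.not_disjoint_iff.1 (h' a List.mem_cons_self)
    have hn : x ∉ s.filter fun x => ∃ a ∈ L, x ∈ f a := fun hm => by
      obtain ⟨b, hb, hxb⟩ := (Finset.mem_filter.1 hm).2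
      exact Finset.disjoint_left.1 (h.1 b hb) hx hxb
    rw [List.length_cons]
    refine le_trans (Nat.succ_le_succ ih) ?_
    rw [Nat.succ_eq_add_one, ← Finset.card_insert_of_notMem hn]
    refine Finset.card_le_card fun y hy => ?_
    rcases Finset.mem_insert.1 hy with rfl | hy
    · exact Finset.mem_filter.2 ⟨hxs, a, List.mem_cons_self, hx⟩
    · obtain ⟨hys, b, hb, hyb⟩ := Finset.mem_filter.1 hy
      exact Finset.mem_filter.2 ⟨hys, b, List.mem_cons_of_mem _ hb, hyb⟩

theorem packing_pairwise : ∀ m c q, (packing m c q).Pairwise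
    (fun a b => Disjoint (a.support \ m.support) (b.support \ m.support)) := by decide

theorem packing_spec : ∀ m c q, ∀ l ∈ packing m c q,
    l ≠ m ∧ (l.src = m.src ∨ c = true) ∧ (l.tgt = m.tgt ∨ q = false) := by decide

/-- Every tile of the packing is a competitor that `s` has to destroy. Since `s` avoids `m`, it must
meet the part of the competitor outside `m`, and these parts are pairwise disjoint. -/
theorem Isolates.packing_le {m : Tile} {c q : Bool} {s : Finset (Fin 12)}
    (h : m.Isolates c q s) (hs : Disjoint m.support s) : (packing m c q).length ≤ s.card := by
  refine (length_le_card (fun l => l.support \ m.support) s _ (packing_pairwise m c q)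
    fun l hl hd => ?_).trans (Finset.card_le_card (Finset.filter_subset _ _))
  obtain ⟨h0, h1, h2⟩ := packing_spec m c q l hl
  refine h0 (h l ?_ h1 h2)
  rw [Finset.disjoint_left] at hd hs ⊢
  intro x hx hxs
  by_cases hm : x ∈ m.support
  · exact hs hm hxs
  · exact hd (Finset.mem_sdiff.2 ⟨hx, hm⟩) hxs

/-- The edges of `ft` lie among those of `ff2`, and those of `tt` among those of `tf`: the links to
the right belong to the next block. No cut inside the block excludes the competitor, so the
following blocks must force the link state. -/
theorem Isolates.right_eq_true {m : Tile} {c q : Bool} {s : Finset (Fin 12)}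
    (h : m.Isolates c q s) (hs : Disjoint m.support s) (hm : m = ff2 ∨ m = tf) : q = true := by
  by_contra hq
  rw [Bool.not_eq_true] at hq
  rcases hm with rfl | rfl
  · exact absurd (h ft (hs.mono_left (by decide)) (Or.inl rfl) (Or.inr hq)) (by decide)
  · exact absurd (h tt (hs.mono_left (by decide)) (Or.inl rfl) (Or.inr hq)) (by decide)

/-- The weight of a tile in the left context `c`, given the weights `g` of the blocks that follow:
the least number of edges to delete in order to isolate the matching. -/
def weight (m : Tile) (g : Bool → ℕ) (c : Bool) : ℕ :=
  match m with
  | ff0 | ff1 | ff3 => g false + 2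
  | ff2 => g true + 2 + c.toNat
  | ff4 => g c + 3
  | ft => g false + 3 + c.toNat
  | tf => g true + 3 * c.toNat
  | tt => g false + 1 + 3 * c.toNat

/-- An optimal set of edges to delete, and the right context in which it works. -/
def optimalCut : Tile → Bool → Bool × Finset (Fin 12)
  | ff0, _ => (false, {8, 10})
  | ff1, _ => (false, {4, 8})
  | ff2, false => (true, {2, 9})
  | ff2, true => (true, {0, 2, 9})
  | ff3, _ => (false, {2, 11})
  | ff4, false => (false, {2, 3, 4})
  | ff4, true => (true, {2, 4, 6})
  | ft, false => (false, {2, 6, 9})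
  | ft, true => (false, {0, 2, 6, 9})
  | tf, false => (true, ∅)
  | tf, true => (true, {2, 3, 9})
  | tt, false => (false, {6})
  | tt, true => (false, {2, 3, 6, 9})

theorem disjoint_optimalCut : ∀ m c, Disjoint (support m) (optimalCut m c).2 := by decide

theorem isolates_optimalCut : ∀ m c, Isolates m c (optimalCut m c).1 (optimalCut m c).2 := by
  unfold Isolates
  decide

theorem weight_eq_optimalCut (m : Tile) (g : Bool → ℕ) (c : Bool) :
    m.weight g c = (optimalCut m c).2.card + g (optimalCut m c).1 := by
  cases m <;> cases c <;> simp [weight, optimalCut] <;> omega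

theorem support_injective : Function.Injective support := by
  unfold Function.Injective
  decide

theorem zero_mem_support : ∀ m : Tile, 0 ∈ m.support ↔ m.src = true := by decide

theorem one_mem_support : ∀ m : Tile, 1 ∈ m.support ↔ m.src = true := by decide

end Tile

/-! ### Chains of tiles and the least cut making a chain rigid. -/

/-- The tiles of `w` fit together, start with the left context `a` and end without a link. -/
def Chain : (n : ℕ) → Bool → (Fin n → Tile) → Prop
  | 0, a, _ => a = false
  | n + 1, a, w => (w 0).src = a ∧ Chain n (w 0).tgt (Fin.tail w)

theorem Chain.context_unique : ∀ {n : ℕ} {a b : Bool} {w : Fin n → Tile},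
    Chain n a w → Chain n b w → a = b
  | 0, _, _, _, h, h' => h.trans h'.symm
  | _ + 1, _, _, _, h, h' => h.1.symm.trans h'.1

theorem chain_iff : ∀ {n : ℕ} {a : Bool} {w : Fin n → Tile}, Chain n a w ↔
    ∃ σ : ℕ → Bool, σ 0 = a ∧ σ n = false ∧
      ∀ i : Fin n, (w i).src = σ i ∧ (w i).tgt = σ (i + 1)
  | 0, a, w => ⟨fun h => ⟨fun _ => a, rfl, h, fun i => i.elim0⟩, fun ⟨σ, h0, h1, _⟩ => h0 ▸ h1⟩
  | n + 1, a, w => by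
    constructor
    · rintro ⟨h0, h⟩
      obtain ⟨σ, hσ, hn, hi⟩ := chain_iff.1 h
      refine ⟨fun k => Nat.casesOn k a σ, rfl, hn, fun i => ?_⟩
      refine Fin.cases ⟨h0, hσ.symm⟩ (fun j => ?_) i
      exact hi j
    · rintro ⟨σ, hσ, hn, hi⟩
      exact ⟨(hi 0).1.trans hσ, chain_iff.2
        ⟨fun k => σ (k + 1), (hi 0).2.symm, hn, fun i => hi i.succ⟩⟩

/-- The matching described by `w` survives the deletion of the edges `s`. -/
def Avoids {n : ℕ} (w : Fin n → Tile) (s : Fin n → Finset (Fin 12)) : Prop :=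
  ∀ i, Disjoint (w i).support (s i)

/-- `w` is the only chain that survives the deletion of `s`, among the chains starting with `a` (or
all chains, if `c`). -/
def Rigid {n : ℕ} (c a : Bool) (w : Fin n → Tile) (s : Fin n → Finset (Fin 12)) : Prop :=
  ∀ b w', (b = a ∨ c = true) → Chain n b w' → Avoids w' s → w' = w

theorem avoids_cons {n : ℕ} {w : Fin (n + 1) → Tile} {s : Fin (n + 1) → Finset (Fin 12)} :
    Avoids w s ↔ Disjoint (w 0).support (s 0) ∧ Avoids (Fin.tail w) (Fin.tail s) :=
  Fin.forall_fin_succ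

/-- The bit `q` records who is responsible for the link state after the first block: the tail if `q`
is true, the first block otherwise. This makes rigidity a local condition. -/
theorem rigid_succ {n : ℕ} {c a : Bool} {w : Fin (n + 1) → Tile}
    {s : Fin (n + 1) → Finset (Fin 12)} (hw : Chain (n + 1) a w) (hs : Avoids w s) :
    Rigid c a w s ↔ ∃ q, (w 0).Isolates c q (s 0) ∧
      Rigid q (w 0).tgt (Fin.tail w) (Fin.tail s) := by
  classical
  obtain ⟨rfl, hw⟩ := hw
  obtain ⟨hs0, hs⟩ := avoids_cons.1 hs
  constructor
  · intro h
    -- Take `q` to say that some surviving first tile has the other right link state; the tail must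
    -- then exclude chains starting with either state.
    refine ⟨decide (∃ l : Tile, Disjoint l.support (s 0) ∧ (l.src = (w 0).src ∨ c = true) ∧
      l.tgt ≠ (w 0).tgt), fun l hl hc hq => ?_, fun b w' hb hw' hs' => ?_⟩
    · have ht : l.tgt = (w 0).tgt := by
        rcases hq with hq | hq
        · exact hq
        · by_contra hne
          exact of_decide_eq_false hq ⟨l, hl, hc, hne⟩
      have := h l.src (Fin.cons l (Fin.tail w)) hc ⟨rfl, by simpa [ht] using hw⟩
        (avoids_cons.2 ⟨by simpa using hl, by simpa using hs⟩)
      simpa using congrFun this 0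
    · obtain ⟨l, hl, hc, ht⟩ : ∃ l : Tile, Disjoint l.support (s 0) ∧
          (l.src = (w 0).src ∨ c = true) ∧ l.tgt = b := by
        by_cases hbt : b = (w 0).tgt
        · exact ⟨w 0, hs0, Or.inl rfl, hbt.symm⟩
        · obtain ⟨l, hl, hc, ht⟩ := of_decide_eq_true (hb.resolve_left hbt)
          refine ⟨l, hl, hc, ?_⟩
          revert ht hbt
          cases l.tgt <;> cases b <;> cases (w 0).tgt <;> simp
      have := h l.src (Fin.cons l w') hc ⟨rfl, by simpa [ht] using hw'⟩
        (avoids_cons.2 ⟨by simpa using hl, by simpa using hs'⟩)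
      rw [← this, Fin.tail_cons]
  · rintro ⟨q, hi, hr⟩ b w' hb ⟨hb', hw'⟩ hs'
    obtain ⟨hs0', hs'⟩ := avoids_cons.1 hs'
    have ht : Fin.tail w' = Fin.tail w := by
      refine hr _ _ ?_ hw' hs'
      cases q
      · exact Or.inl (congrArg _ (hi _ hs0' (hb' ▸ hb) (Or.inr rfl)))
      · exact Or.inr rfl
    have h0 : w' 0 = w 0 :=
      hi _ hs0' (hb' ▸ hb) (Or.inl ((ht ▸ hw').context_unique hw))
    rw [← Fin.cons_self_tail w', ← Fin.cons_self_tail w, ht, h0]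

/-- The least number of edges to delete in order to make the chain `w` rigid. -/
def minCut : (n : ℕ) → (Fin n → Tile) → Bool → ℕ
  | 0, _ => fun _ => 0
  | n + 1, w => (w 0).weight (minCut n (Fin.tail w))

/-- The price of forcing the left link state instead of being given it: at most 1 for an unlinked
start, exactly 3 for a linked one. These gaps decide which `q` is cheaper for each tile, and hence
the form of `weight`. -/
theorem minCut_gap : ∀ {n : ℕ} {a : Bool} {w : Fin n → Tile}, Chain n a w →
    minCut n w false ≤ minCut n w true ∧
      (a = false → minCut n w true ≤ minCut n w false + 1) ∧
      (a = true → minCut n w true = minCut n w false + 3)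
  | 0, a, w, h => by simp [minCut, show a = false from h]
  | n + 1, a, w, h => by
    obtain ⟨h0, h⟩ := h
    have ih := minCut_gap h
    rw [minCut]
    generalize w 0 = m at *
    subst h0
    cases m <;> simp [Tile.weight, Tile.src, Tile.tgt] at ih ⊢
    omega

/-- For the bit `q` supplied by `rigid_succ`, the packing bounds the cut of the first block and
induction bounds the rest; `minCut_gap` compares the result with the bit chosen in `weight`. -/
theorem minCut_le : ∀ {n : ℕ} {c a : Bool} {w : Fin n → Tile} {s : Fin n → Finset (Fin 12)},
    Chain n a w → Avoids w s → Rigid c a w s → minCut n w c ≤ ∑ i, (s i).card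
  | 0, _, _, _, _, _, _, _ => Nat.zero_le _
  | n + 1, c, a, w, s, hw, hs, hr => by
    obtain ⟨q, hi, hr⟩ := (rigid_succ hw hs).1 hr
    obtain ⟨-, hw⟩ := hw
    obtain ⟨hs0, hs⟩ := avoids_cons.1 hs
    have ih := minCut_le hw hs hr
    have hp := hi.packing_le hs0
    have hq := hi.right_eq_true hs0
    have hg := minCut_gap hw
    rw [minCut, Fin.sum_univ_succ]
    change _ ≤ (s 0).card + ∑ i, (Fin.tail s i).card
    generalize ∑ i, (Fin.tail s i).card = N at *
    generalize (s 0).card = k at *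
    generalize w 0 = m at *
    cases m <;> cases c <;> cases q <;>
      simp [Tile.weight, Tile.tgt, Tile.packing] at ih hp hq hg ⊢ <;> omega

theorem exists_rigid : ∀ {n : ℕ} (c : Bool) {a : Bool} {w : Fin n → Tile}, Chain n a w →
    ∃ s, Avoids w s ∧ Rigid c a w s ∧ ∑ i, (s i).card = minCut n w c
  | 0, _, _, _, _ => ⟨fun _ => ∅, fun i => i.elim0, fun _ _ _ _ _ => Subsingleton.elim _ _, rfl⟩
  | n + 1, c, a, w, hw => by
    obtain ⟨s, hs, hr, hc⟩ := exists_rigid ((w 0).optimalCut c).1 hw.2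
    have hs' : Avoids w (Fin.cons ((w 0).optimalCut c).2 s : Fin (n + 1) → _) :=
      avoids_cons.2 ⟨by simpa using Tile.disjoint_optimalCut _ _, by simpa using hs⟩
    refine ⟨_, hs', (rigid_succ hw hs').2 ⟨_, ?_, hr⟩, ?_⟩
    · simpa using Tile.isolates_optimalCut (w 0) c
    · rw [Fin.sum_univ_succ]
      simp only [Fin.cons_zero, Fin.cons_succ]
      rw [hc, minCut, Tile.weight_eq_optimalCut]

/-! ### Generating polynomials and the transfer matrix. -/

open Classical in
/-- The generating polynomial of the chains starting with `a`, by the statistic `f` of their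
values of `minCut`. -/
noncomputable def chainPolynomial (n : ℕ) (a : Bool) (f : (Bool → ℕ) → ℕ) : ℤ[X] :=
  ∑ w : Fin n → Tile with Chain n a w, X ^ f (minCut n w)

theorem chainPolynomial_zero (a c : Bool) :
    chainPolynomial 0 a (fun g => g c) = if a then 0 else 1 := by
  cases a <;> simp [chainPolynomial, Chain, minCut]

theorem chainPolynomial_add (n : ℕ) (a : Bool) (f : (Bool → ℕ) → ℕ) (k : ℕ) :
    chainPolynomial n a (fun g => f g + k) = X ^ k * chainPolynomial n a f := by
  simp only [chainPolynomial, pow_add, Finset.mul_sum, mul_comm]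

theorem chain_cons {n : ℕ} {a : Bool} {m : Tile} {w : Fin n → Tile} :
    Chain (n + 1) a (Fin.cons m w) ↔ m.src = a ∧ Chain n m.tgt w := Iff.rfl

theorem chainPolynomial_succ (n : ℕ) (a : Bool) (f : (Bool → ℕ) → ℕ) :
    chainPolynomial (n + 1) a f =
      ∑ m : Tile, if m.src = a then chainPolynomial n m.tgt (fun g => f (m.weight g)) else 0 := by
  classical
  rw [chainPolynomial, Finset.sum_filter,
    ← (Fin.consEquiv fun _ : Fin (n + 1) => Tile).sum_comp, Fintype.sum_prod_type]
  refine Finset.sum_congr rfl fun m _ => ?_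
  rw [chainPolynomial, Finset.sum_filter]
  by_cases h : m.src = a
  · rw [if_pos h]
    exact Finset.sum_congr rfl fun w _ => if_congr (chain_cons.trans (and_iff_right h)) rfl rfl
  · rw [if_neg h]
    exact Finset.sum_eq_zero fun w _ => if_neg fun hc => h hc.1

theorem univ_tile : (Finset.univ : Finset Tile) =
    {.ff0, .ff1, .ff2, .ff3, .ff4, .ft, .tf, .tt} := rfl

/-- This and the next two identities are the rows of the transfer matrix. The system closes because
`ft` and `tt` always evaluate the tail at `false`, so linked chains that must force their start
never occur. -/
theorem chainPolynomial_succ_false_false (n : ℕ) :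
    chainPolynomial (n + 1) false (fun g => g false) =
      (3 * X ^ 2 + X ^ 3) * chainPolynomial n false (fun g => g false)
        + X ^ 2 * chainPolynomial n false (fun g => g true)
        + X ^ 3 * chainPolynomial n true (fun g => g false) := by
  rw [chainPolynomial_succ, univ_tile]
  simp [Tile.src, Tile.tgt, Tile.weight, chainPolynomial_add]
  ring

theorem chainPolynomial_succ_false_true (n : ℕ) :
    chainPolynomial (n + 1) false (fun g => g true) =
      3 * X ^ 2 * chainPolynomial n false (fun g => g false)
        + 2 * X ^ 3 * chainPolynomial n false (fun g => g true)
        + X ^ 4 * chainPolynomial n true (fun g => g false) := by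
  rw [chainPolynomial_succ, univ_tile]
  simp [Tile.src, Tile.tgt, Tile.weight, chainPolynomial_add]
  ring

theorem chainPolynomial_succ_true_false (n : ℕ) :
    chainPolynomial (n + 1) true (fun g => g false) =
      chainPolynomial n false (fun g => g true)
        + X * chainPolynomial n true (fun g => g false) := by
  rw [chainPolynomial_succ, univ_tile]
  simp [Tile.src, Tile.tgt, Tile.weight, chainPolynomial_add]

/-! ### Perfect matchings and anti-forcing sets as plain edge sets. -/

section PerfectMatchings

variable {V : Type*} {G : SimpleGraph V} {M S : Finset (Sym2 V)}

theorem isPerfectMatchingEdges_iff :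
    IsPerfectMatchingEdges G M ↔ (M : Set (Sym2 V)) ⊆ G.edgeSet ∧ ∀ v, ∃! e, e ∈ M ∧ v ∈ e := by
  constructor
  · rintro ⟨P, hP, hM⟩
    refine ⟨hM ▸ P.edgeSet_subset, fun v => ?_⟩
    have hmem : ∀ a b, s(a, b) ∈ M ↔ P.Adj a b := fun a b => by
      rw [← Finset.mem_coe, ← hM, SimpleGraph.Subgraph.mem_edgeSet]
    obtain ⟨w, hw, hu⟩ := SimpleGraph.Subgraph.isPerfectMatching_iff.1 hP v
    refine ⟨s(v, w), ⟨(hmem _ _).2 hw, Sym2.mem_mk_left _ _⟩, ?_⟩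
    rintro e ⟨he, hv⟩
    obtain ⟨x, rfl⟩ := Sym2.mem_iff_exists.1 hv
    rw [hu x ((hmem _ _).1 he)]
  · rintro ⟨hM, h⟩
    let P : G.Subgraph :=
      { verts := Set.univ
        Adj := fun a b => s(a, b) ∈ M
        adj_sub := fun {a b} hab => hM hab
        edge_vert := fun _ => trivial
        symm := ⟨fun a b hab => Sym2.eq_swap (a := a) (b := b) ▸ hab⟩ }
    refine ⟨P, SimpleGraph.Subgraph.isPerfectMatching_iff.2 fun v => ?_, ?_⟩
    · obtain ⟨e, ⟨he, hv⟩, hu⟩ := h v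
      obtain ⟨x, rfl⟩ := Sym2.mem_iff_exists.1 hv
      exact ⟨x, he, fun y hy => Sym2.congr_right.1 (hu s(v, y) ⟨hy, Sym2.mem_mk_left _ _⟩)⟩
    · ext e
      induction e with
      | _ a b => exact Iff.rfl

theorem isPerfectMatchingEdges_deleteEdges_iff :
    IsPerfectMatchingEdges (G.deleteEdges (S : Set (Sym2 V))) M ↔
      IsPerfectMatchingEdges G M ∧ Disjoint M S := by
  rw [isPerfectMatchingEdges_iff, isPerfectMatchingEdges_iff, SimpleGraph.edgeSet_deleteEdges,
    Set.subset_sdiff, Finset.disjoint_coe]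
  tauto

theorem isAntiForcingSet_iff (hM : IsPerfectMatchingEdges G M) :
    IsAntiForcingSet G M S ↔ (S : Set (Sym2 V)) ⊆ G.edgeSet ∧ Disjoint M S ∧
      ∀ N, IsPerfectMatchingEdges G N → Disjoint N S → N = M := by
  simp only [IsAntiForcingSet, isPerfectMatchingEdges_deleteEdges_iff, Set.subset_sdiff,
    Finset.disjoint_coe]
  constructor
  · rintro ⟨⟨h1, h2⟩, h3⟩
    exact ⟨h1, h2.symm, fun N hN hd => (h3 N).1 ⟨hN, hd⟩⟩
  · rintro ⟨h1, h2, h3⟩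
    exact ⟨⟨h1, h2.symm⟩, fun N => ⟨fun h => h3 N h.1 h.2, fun h => h ▸ ⟨hM, h2⟩⟩⟩

end PerfectMatchings

/-! ### Coordinates for the vertices and edges of the graph. -/

namespace Polyomino

/-- A label for an edge of `G_n`: `none` is the edge `u_0 v_0`, and `some (i, e)` is the edge number
`e` of the block `i`, numbered as in `Tile.support`. -/
abbrev Label : Type := Option (ℕ × Fin 12)

/-- Positions of the lower ends of the edges of a block, relative to the column `2 i`. -/
def lowerOffset : Fin 12 → ℕ × Fin 4 :=
  ![(0, 1), (0, 2), (1, 0), (1, 1), (1, 2), (2, 0), (2, 1), (2, 2), (1, 0), (1, 1), (1, 2), (1, 3)]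

/-- Positions of the upper ends of the edges of a block, relative to the column `2 i`. -/
def upperOffset : Fin 12 → ℕ × Fin 4 :=
  ![(1, 1), (1, 2), (1, 1), (1, 2), (1, 3), (2, 1), (2, 2), (2, 3), (2, 0), (2, 1), (2, 2), (2, 3)]

namespace Label

/-- The column and row of the lower end of an edge. -/
def lower : Label → ℕ × Fin 4
  | none => (0, 1)
  | some (i, e) => (2 * i + (lowerOffset e).1, (lowerOffset e).2)

/-- The column and row of the upper end of an edge. -/
def upper : Label → ℕ × Fin 4
  | none => (0, 2)
  | some (i, e) => (2 * i + (upperOffset e).1, (upperOffset e).2)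

/-- The label belongs to an edge of `G_n`. -/
def Valid (n : ℕ) : Label → Prop
  | none => True
  | some (i, _) => i < n

/-- The edge ends at `p`. -/
def Incident (p : ℕ × Fin 4) (x : Label) : Prop := p = x.lower ∨ p = x.upper

/-- Column plus row orients every edge; this excludes two labels naming one edge with its ends
exchanged. -/
theorem upper_sum : ∀ x : Label,
    x.upper.1 + x.upper.2.val = x.lower.1 + x.lower.2.val + 1
  | none => rfl
  | some (i, e) => by
    have : ∀ e, (upperOffset e).1 + (upperOffset e).2.val =
      (lowerOffset e).1 + (lowerOffset e).2.val + 1 := by decide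
    simp only [lower, upper]
    have := this e
    omega

theorem ends_injective {x y : Label} (h : x.lower = y.lower) (h' : x.upper = y.upper) : x = y := by
  have h1 : ∀ e e', (lowerOffset e).2 = (lowerOffset e').2 →
      (upperOffset e).2 = (upperOffset e').2 →
      (lowerOffset e).1 % 2 = (lowerOffset e').1 % 2 →
      (lowerOffset e).1 + (upperOffset e').1 = (lowerOffset e').1 + (upperOffset e).1 →
      e = e' := by decide
  have h2 : ∀ e, (lowerOffset e).1 = 0 → (upperOffset e).1 ≠ 0 := by decide
  match x, y with
  | none, none => rfl
  | none, some (i, e) =>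
    simp only [lower, upper, Prod.mk.injEq] at h h'
    exact absurd (by omega) (h2 e (by omega))
  | some (i, e), none =>
    simp only [lower, upper, Prod.mk.injEq] at h h'
    exact absurd (by omega) (h2 e (by omega))
  | some (i, e), some (j, e') =>
    simp only [lower, upper, Prod.mk.injEq] at h h'
    obtain rfl := h1 e e' h.2 h'.2 (by omega) (by omega)
    obtain rfl : i = j := by omega
    rfl

end Label

/-- The position can be occupied by a vertex of `G_n`. -/
def Admissible (n : ℕ) (p : ℕ × Fin 4) : Prop :=
  p.1 < 2 * n + 1 ∧ (p.1 = 0 → p.2 = 1 ∨ p.2 = 2)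

theorem Label.Valid.admissible_lower {n : ℕ} : ∀ {x : Label}, x.Valid n → Admissible n x.lower
  | none, _ => ⟨Nat.succ_pos _, fun _ => Or.inl rfl⟩
  | some (i, e), h => by
    have h1 : ∀ e, (lowerOffset e).1 ≤ 2 ∧
      ((lowerOffset e).1 = 0 → (lowerOffset e).2 = 1 ∨ (lowerOffset e).2 = 2) := by decide
    have h : i < n := h
    have := (h1 e).1
    exact ⟨by simp only [Label.lower]; omega,
      fun h0 => (h1 e).2 (by simp only [Label.lower] at h0; omega)⟩

theorem Label.Valid.admissible_upper {n : ℕ} : ∀ {x : Label}, x.Valid n → Admissible n x.upper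
  | none, _ => ⟨Nat.succ_pos _, fun _ => Or.inr rfl⟩
  | some (i, e), h => by
    have h1 : ∀ e, (upperOffset e).1 ≤ 2 ∧ (upperOffset e).1 ≠ 0 := by decide
    have h : i < n := h
    have := h1 e
    exact ⟨by simp only [Label.upper]; omega,
      fun h0 => absurd h0 (by simp only [Label.upper]; omega)⟩

/-- The adjacency relation of `G_n`, from lower to upper ends, in terms of positions. -/
def Step (p q : ℕ × Fin 4) : Prop :=
  (p.1 = q.1 ∧ p.2.val + 1 = q.2.val) ∨
    (p.1 + 1 = q.1 ∧ p.2 = q.2 ∧ (p.2 = 1 ∨ p.2 = 2 ∨ Odd p.1))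

theorem Label.step : ∀ x : Label, Step x.lower x.upper
  | none => Or.inl ⟨rfl, rfl⟩
  | some (i, e) => by
    have h : ∀ e, ((lowerOffset e).1 = (upperOffset e).1 ∧
          (lowerOffset e).2.val + 1 = (upperOffset e).2.val) ∨
        ((lowerOffset e).1 + 1 = (upperOffset e).1 ∧ (lowerOffset e).2 = (upperOffset e).2 ∧
          ((lowerOffset e).2 = 1 ∨ (lowerOffset e).2 = 2 ∨ (lowerOffset e).1 = 1)) := by decide
    simp only [Step, Label.lower, Label.upper]
    rcases h e with ⟨h1, h2⟩ | ⟨h1, h2, h3⟩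
    · exact Or.inl ⟨by omega, h2⟩
    · exact Or.inr ⟨by omega, h2, h3.imp id (Or.imp id
        fun h3 => by rw [h3]; exact odd_two_mul_add_one i)⟩

theorem exists_label {n : ℕ} {p q : ℕ × Fin 4} (hp : Admissible n p)
    (hq : Admissible n q) (h : Step p q) : ∃ x : Label, x.Valid n ∧ x.lower = p ∧ x.upper = q := by
  have hv : ∀ r r' : Fin 4, r.val + 1 = r'.val → ∃ e : Fin 12, lowerOffset e = (1, r) ∧
      upperOffset e = (1, r') := by decide
  have hv' : ∀ r r' : Fin 4, r.val + 1 = r'.val → ∃ e : Fin 12, lowerOffset e = (2, r) ∧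
      upperOffset e = (2, r') := by decide
  have hh : ∀ r : Fin 4, ∃ e : Fin 12, lowerOffset e = (1, r) ∧ upperOffset e = (2, r) := by decide
  have hh' : ∀ r : Fin 4, r = 1 ∨ r = 2 → ∃ e : Fin 12, lowerOffset e = (0, r) ∧
      upperOffset e = (1, r) := by decide
  obtain ⟨c, r⟩ := p
  obtain ⟨c', r'⟩ := q
  obtain ⟨hp1, hp2⟩ := hp
  obtain ⟨hq1, hq2⟩ := hq
  simp only at hp1 hp2 hq1 hq2
  have key : ∀ i d d', i < n → c = 2 * i + d → c' = 2 * i + d' →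
      (∃ e, lowerOffset e = (d, r) ∧ upperOffset e = (d', r')) →
      ∃ x : Label, x.Valid n ∧ x.lower = (c, r) ∧ x.upper = (c', r') := by
    rintro i d d' hi rfl rfl ⟨e, h1, h2⟩
    exact ⟨some (i, e), hi, by simp [Label.lower, h1], by simp [Label.upper, h2]⟩
  rcases h with ⟨h1, h2⟩ | ⟨h1, h2, h3⟩ <;> simp only at h1 h2
  · rcases Nat.eq_zero_or_pos c with h0 | h0
    · refine ⟨none, trivial, ?_, ?_⟩
      · have := hp2 h0
        have := hq2 (by omega)
        simp only [Label.lower, Prod.mk.injEq]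
        omega
      · have := hp2 h0
        have := hq2 (by omega)
        simp only [Label.upper, Prod.mk.injEq]
        omega
    -- A positive even column `2 k` is the second column of block `k - 1`; column `2 k + 1` is the
    -- first of block `k`.
    · rcases Nat.even_or_odd' c with ⟨k, hk | hk⟩
      · exact key (k - 1) 2 2 (by omega) (by omega) (by omega) (hv' r r' h2)
      · exact key k 1 1 (by omega) (by omega) (by omega) (hv r r' h2)
  · subst h2
    rcases Nat.even_or_odd' c with ⟨k, hk | hk⟩
    · refine key k 0 1 (by omega) (by omega) (by omega) (hh' r ?_)
      rcases h3 with h3 | h3 | h3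
      · exact Or.inl h3
      · exact Or.inr h3
      · exact absurd h3 (by simp only [hk]; exact Nat.not_odd_iff_even.2 (even_two_mul k))
    · exact key k 1 2 (by omega) (by omega) (by omega) (hh r)

variable {n : ℕ} (hn : 0 < n)

/-- The vertex of `G_n` at a position (and `u_0` if there is none). -/
noncomputable def vertexAt (p : ℕ × Fin 4) : PolyominoVertex n :=
  open Classical in
  if h : Admissible n p then ⟨(⟨p.1, h.1⟩, p.2), hn, h.2⟩
  else ⟨(⟨0, Nat.succ_pos _⟩, 1), hn, fun _ => Or.inl rfl⟩

/-- The column and row of a vertex. -/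
def position (v : PolyominoVertex n) : ℕ × Fin 4 := (v.1.1.val, v.1.2)

theorem admissible_position (v : PolyominoVertex n) : Admissible n (position v) :=
  ⟨v.1.1.isLt, v.2.2⟩

theorem position_injective : Function.Injective (position (n := n)) := fun v w h => by
  simp only [position, Prod.mk.injEq] at h
  exact Subtype.ext (Prod.ext (Fin.ext h.1) h.2)

theorem position_vertexAt {p : ℕ × Fin 4} (h : Admissible n p) : position (vertexAt hn p) = p := by
  simp [vertexAt, h, position]

theorem eq_vertexAt {p : ℕ × Fin 4} (h : Admissible n p) (v : PolyominoVertex n) :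
    v = vertexAt hn p ↔ position v = p := by
  rw [← position_injective.eq_iff, position_vertexAt hn h]

/-- The edge of `G_n` with a given label. -/
noncomputable def edge (x : Label) : Sym2 (PolyominoVertex n) :=
  s(vertexAt hn x.lower, vertexAt hn x.upper)

theorem mem_edge {x : Label} (hx : x.Valid n) (v : PolyominoVertex n) :
    v ∈ edge hn x ↔ x.Incident (position v) := by
  rw [edge, Sym2.mem_iff, eq_vertexAt hn hx.admissible_lower, eq_vertexAt hn hx.admissible_upper,
    Label.Incident]

theorem edge_inj {x y : Label} (hx : x.Valid n) (hy : y.Valid n) :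
    edge hn x = edge hn y ↔ x = y := by
  refine ⟨fun h => ?_, fun h => h ▸ rfl⟩
  rw [edge, edge, Sym2.eq_iff, eq_vertexAt hn hy.admissible_lower,
    eq_vertexAt hn hy.admissible_upper, eq_vertexAt hn hy.admissible_lower,
    eq_vertexAt hn hy.admissible_upper, position_vertexAt hn hx.admissible_lower,
    position_vertexAt hn hx.admissible_upper] at h
  rcases h with ⟨h1, h2⟩ | ⟨h1, h2⟩
  · exact Label.ends_injective h1 h2
  · have h3 := x.upper_sum
    have h4 := y.upper_sum
    rw [h1, h2] at h3
    omega

theorem polyominoGraph_adj_iff (v w : PolyominoVertex n) : (polyominoGraph n).Adj v w ↔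
    Step (position v) (position w) ∨ Step (position w) (position v) := by
  have hne : ∀ v w : PolyominoVertex n, Step (position v) (position w) → v ≠ w := by
    rintro v _ (h | h) rfl <;> omega
  have hs : ∀ v w : PolyominoVertex n, Step (position v) (position w) ↔
      (v.1.1 = w.1.1 ∧ v.1.2.val + 1 = w.1.2.val) ∨
      (v.1.1.val + 1 = w.1.1.val ∧ v.1.2 = w.1.2 ∧
        (v.1.2 = 1 ∨ v.1.2 = 2 ∨ Odd v.1.1.val)) := fun v w => by
    simp only [Step, position, Fin.ext_iff]
  rw [polyominoGraph, SimpleGraph.fromRel_adj, ← hs, ← hs]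
  exact ⟨fun h => h.2, fun h => ⟨h.elim (hne v w) fun h => (hne w v h).symm, h⟩⟩

theorem mem_edgeSet_iff (e : Sym2 (PolyominoVertex n)) :
    e ∈ (polyominoGraph n).edgeSet ↔ ∃ x : Label, x.Valid n ∧ edge hn x = e := by
  constructor
  · induction e with
    | _ v w =>
      rw [SimpleGraph.mem_edgeSet, polyominoGraph_adj_iff]
      rintro (h | h)
      · obtain ⟨x, hx, h1, h2⟩ := exists_label (admissible_position _) (admissible_position _) h
        refine ⟨x, hx, ?_⟩
        rw [edge, ← (eq_vertexAt hn hx.admissible_lower v).2 h1.symm,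
          ← (eq_vertexAt hn hx.admissible_upper w).2 h2.symm]
      · obtain ⟨x, hx, h1, h2⟩ := exists_label (admissible_position _) (admissible_position _) h
        refine ⟨x, hx, ?_⟩
        rw [edge, ← (eq_vertexAt hn hx.admissible_lower w).2 h1.symm,
          ← (eq_vertexAt hn hx.admissible_upper v).2 h2.symm, Sym2.eq_swap]
  · rintro ⟨x, hx, rfl⟩
    rw [edge, SimpleGraph.mem_edgeSet, polyominoGraph_adj_iff,
      position_vertexAt hn hx.admissible_lower, position_vertexAt hn hx.admissible_upper]
    exact Or.inl x.step

/-! ### Local matchings at a block are exactly the tiles. -/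

/-- The edges at a block: those of the block and the two links to the next block. -/
def localLabel (i : ℕ) : Fin 14 → Label :=
  ![some (i, 0), some (i, 1), some (i, 2), some (i, 3), some (i, 4), some (i, 5), some (i, 6),
    some (i, 7), some (i, 8), some (i, 9), some (i, 10), some (i, 11), some (i + 1, 0),
    some (i + 1, 1)]

/-- The edges at each of the eight vertices of a block. -/
def star : Fin 2 → Fin 4 → Finset (Fin 14) :=
  ![![{2, 8}, {0, 2, 3, 9}, {1, 3, 4, 10}, {4, 11}],
    ![{5, 8}, {5, 6, 9, 12}, {6, 7, 10, 13}, {7, 11}]]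

theorem incident_zero_one (x : Label) :
    x.Incident (0, 1) ↔ x = none ∨ x = some (0, 0) := by
  match x with
  | none => simp [Label.Incident, Label.lower]
  | some (i, e) =>
    fin_cases e <;> simp [Label.Incident, Label.lower, Label.upper, lowerOffset, upperOffset]

theorem incident_zero_two (x : Label) :
    x.Incident (0, 2) ↔ x = none ∨ x = some (0, 1) := by
  match x with
  | none => simp [Label.Incident, Label.upper]
  | some (i, e) =>
    fin_cases e <;> simp [Label.Incident, Label.lower, Label.upper, lowerOffset, upperOffset]

theorem incident_block (i : ℕ) (d : Fin 2) (r : Fin 4) (x : Label) :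
    x.Incident (2 * i + 1 + d, r) ↔ ∃ k ∈ star d r, x = localLabel i k := by
  match x with
  | none =>
    fin_cases d <;> fin_cases r <;>
      simp [Label.Incident, Label.lower, Label.upper, localLabel, star]
  | some (j, e) =>
    fin_cases d <;> fin_cases r <;>
      simp [Label.Incident, Label.lower, Label.upper, localLabel, star] <;>
    fin_cases e <;> simp [lowerOffset, upperOffset] <;> omega

end Polyomino

namespace Tile

/-- The matching edges at a block: those of the tile and the links to the next block. -/
def extendedSupport (m : Tile) : Finset (Fin 14) :=
  m.support.map (Fin.castLEEmb (by decide)) ∪ if m.tgt then {12, 13} else ∅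

theorem castLE_mem_extendedSupport : ∀ (m : Tile) (e : Fin 12),
    Fin.castLE (by decide) e ∈ m.extendedSupport ↔ e ∈ m.support := by decide

theorem twelve_mem_extendedSupport : ∀ m : Tile, 12 ∈ m.extendedSupport ↔ m.tgt = true := by
  decide

theorem thirteen_mem_extendedSupport : ∀ m : Tile, 13 ∈ m.extendedSupport ↔ m.tgt = true := by
  decide

end Tile

namespace Polyomino

/-- Each of the eight vertices of a block is covered exactly once by the edges in `t`. -/
def IsLocalMatching (t : Fin 14 → Prop) : Prop :=
  ∀ d r, ∃! k, k ∈ star d r ∧ t k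

theorem isLocalMatching_tile : ∀ m : Tile, IsLocalMatching (· ∈ m.extendedSupport) := by
  simp only [IsLocalMatching, ExistsUnique]
  decide

-- A finite check, with one variable `b0` for the two left links. Each vertex condition comes as
-- soon as its variables are introduced, so that the case search is pruned early.
set_option synthInstance.maxHeartbeats 400000 in
set_option synthInstance.maxSize 100000 in
set_option maxRecDepth 10000 in
theorem exists_tile_of_xor : ∀ b2 b8, xor b2 b8 = true → ∀ b5, xor b5 b8 = true →
    ∀ b4 b11, xor b4 b11 = true → ∀ b7, xor b7 b11 = true →
    ∀ b0 b3 b9, (b0 || b2 || b3 || b9) = true → (b0 && b2 || b0 && b3 || b0 && b9 || b2 && b3 ||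
      b2 && b9 || b3 && b9) = false →
    ∀ b10, (b0 || b3 || b4 || b10) = true → (b0 && b3 || b0 && b4 || b0 && b10 || b3 && b4 ||
      b3 && b10 || b4 && b10) = false →
    ∀ b6 b12, (b5 || b6 || b9 || b12) = true → (b5 && b6 || b5 && b9 || b5 && b12 || b6 && b9 ||
      b6 && b12 || b9 && b12) = false →
    ∀ b13, (b6 || b7 || b10 || b13) = true → (b6 && b7 || b6 && b10 || b6 && b13 || b7 && b10 ||
      b7 && b13 || b10 && b13) = false →
    ∃ m : Tile, ∀ k : Fin 14,
      ![b0, b0, b2, b3, b4, b5, b6, b7, b8, b9, b10, b11, b12, b13] k = true ↔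
        k ∈ m.extendedSupport := by
  decide

theorem existsUnique_pair {t : Fin 14 → Bool} {i j : Fin 14} (hij : i ≠ j)
    (h : ∃! k, k ∈ ({i, j} : Finset (Fin 14)) ∧ t k = true) : xor (t i) (t j) = true := by
  obtain ⟨k, ⟨hk, htk⟩, hu⟩ := h
  have hi := hu i
  have hj := hu j
  simp only [Finset.mem_insert, Finset.mem_singleton, true_or, or_true, true_and] at hk hi hj
  cases h1 : t i <;> cases h2 : t j <;> simp_all
  grind

theorem existsUnique_quadruple {t : Fin 14 → Bool} {i j k l : Fin 14}
    (hij : i ≠ j) (hik : i ≠ k) (hil : i ≠ l) (hjk : j ≠ k) (hjl : j ≠ l) (hkl : k ≠ l)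
    (h : ∃! x, x ∈ ({i, j, k, l} : Finset (Fin 14)) ∧ t x = true) :
    (t i || t j || t k || t l) = true ∧
      (t i && t j || t i && t k || t i && t l || t j && t k || t j && t l || t k && t l) =
        false := by
  obtain ⟨x, ⟨hx, htx⟩, hu⟩ := h
  have hi := hu i
  have hj := hu j
  have hk := hu k
  have hl := hu l
  simp only [Finset.mem_insert, Finset.mem_singleton, true_or, or_true, true_and] at hx hi hj hk hl
  cases h1 : t i <;> cases h2 : t j <;> cases h3 : t k <;> cases h4 : t l <;> grind

theorem IsLocalMatching.exists_tile {t : Fin 14 → Prop} (h : IsLocalMatching t)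
    (h01 : t 0 ↔ t 1) : ∃ m : Tile, ∀ k, t k ↔ k ∈ m.extendedSupport := by
  classical
  obtain ⟨b, hb⟩ : ∃ b : Fin 14 → Bool, ∀ k, t k ↔ b k = true :=
    ⟨fun k => decide (t k), fun k => decide_eq_true_iff.symm⟩
  simp only [IsLocalMatching, hb] at h h01
  have h01 : b 1 = b 0 := Bool.eq_iff_iff.2 h01.symm
  have q1 := existsUnique_quadruple (by decide) (by decide) (by decide) (by decide) (by decide)
    (by decide) (h 0 1)
  have q2 := existsUnique_quadruple (by decide) (by decide) (by decide) (by decide) (by decide)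
    (by decide) (h 0 2)
  have q3 := existsUnique_quadruple (by decide) (by decide) (by decide) (by decide) (by decide)
    (by decide) (h 1 1)
  have q4 := existsUnique_quadruple (by decide) (by decide) (by decide) (by decide) (by decide)
    (by decide) (h 1 2)
  rw [h01] at q2
  obtain ⟨m, hm⟩ := exists_tile_of_xor _ _ (existsUnique_pair (by decide) (h 0 0)) _
    (existsUnique_pair (by decide) (h 1 0)) _ _ (existsUnique_pair (by decide) (h 0 3)) _
    (existsUnique_pair (by decide) (h 1 3)) _ _ _ q1.1 q1.2 _ q2.1 q2.2 _ _ q3.1 q3.2 _ q4.1 q4.2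
  refine ⟨m, fun k => (hb k).trans (Iff.trans ?_ (hm k))⟩
  fin_cases k <;> first | rfl | exact Bool.eq_iff_iff.1 h01

/-! ### Perfect matchings correspond to chains of tiles. -/

variable {n : ℕ} (hn : 0 < n)

/-- The edge with a given label exists in `G_n` and belongs to `M`. -/
def HasEdge (M : Finset (Sym2 (PolyominoVertex n))) (x : Label) : Prop :=
  x.Valid n ∧ edge hn x ∈ M

theorem existsUnique_mem_iff {M : Finset (Sym2 (PolyominoVertex n))}
    (hM : (M : Set (Sym2 (PolyominoVertex n))) ⊆ (polyominoGraph n).edgeSet)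
    (v : PolyominoVertex n) :
    (∃! e, e ∈ M ∧ v ∈ e) ↔ ∃! x : Label, HasEdge hn M x ∧ x.Incident (position v) := by
  constructor
  · rintro ⟨e, ⟨he, hv⟩, hu⟩
    obtain ⟨x, hx, rfl⟩ := (mem_edgeSet_iff hn e).1 (hM he)
    refine ⟨x, ⟨⟨hx, he⟩, (mem_edge hn hx v).1 hv⟩, ?_⟩
    rintro y ⟨⟨hy, hyM⟩, hyv⟩
    exact (edge_inj hn hy hx).1 (hu _ ⟨hyM, (mem_edge hn hy v).2 hyv⟩)
  · rintro ⟨x, ⟨⟨hx, he⟩, hv⟩, hu⟩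
    refine ⟨edge hn x, ⟨he, (mem_edge hn hx v).2 hv⟩, ?_⟩
    rintro e ⟨heM, hve⟩
    obtain ⟨y, hy, rfl⟩ := (mem_edgeSet_iff hn e).1 (hM heM)
    rw [hu y ⟨⟨hy, heM⟩, (mem_edge hn hy v).1 hve⟩]

theorem localLabel_injective (i : ℕ) : Function.Injective (localLabel i) := by
  intro j k h
  fin_cases j <;> fin_cases k <;> first | rfl | (exfalso; revert h; simp [localLabel])

theorem existsUnique_incident_block (B : Label → Prop) (i : ℕ) (d : Fin 2) (r : Fin 4) :
    (∃! x : Label, B x ∧ x.Incident (2 * i + 1 + d, r)) ↔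
      ∃! k, k ∈ star d r ∧ B (localLabel i k) := by
  simp only [incident_block]
  constructor
  · rintro ⟨_, ⟨hB, k, hk, rfl⟩, hu⟩
    exact ⟨k, ⟨hk, hB⟩, fun l hl => localLabel_injective i (hu _ ⟨hl.2, l, hl.1, rfl⟩)⟩
  · rintro ⟨k, ⟨hk, hB⟩, hu⟩
    refine ⟨_, ⟨hB, k, hk, rfl⟩, ?_⟩
    rintro _ ⟨hB', l, hl, rfl⟩
    rw [hu l ⟨hl, hB'⟩]

theorem existsUnique_incident_zero (B : Label → Prop) {p : ℕ × Fin 4} {y : Label} (hy : y ≠ none)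
    (hp : ∀ x : Label, x.Incident p ↔ x = none ∨ x = y) :
    (∃! x : Label, B x ∧ x.Incident p) ↔ (B y ↔ ¬ B none) := by
  simp only [hp]
  constructor
  · rintro ⟨x, ⟨hB, rfl | rfl⟩, hu⟩
    · exact ⟨fun h => absurd (hu y ⟨h, Or.inr rfl⟩) hy, fun h => absurd hB h⟩
    · exact ⟨fun _ h => hy (hu none ⟨h, Or.inl rfl⟩).symm, fun _ => hB⟩
  · intro h
    by_cases h0 : B none
    · refine ⟨none, ⟨h0, Or.inl rfl⟩, ?_⟩
      rintro x ⟨hx, rfl | rfl⟩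
      · rfl
      · exact absurd h0 (h.1 hx)
    · refine ⟨y, ⟨h.2 h0, Or.inr rfl⟩, ?_⟩
      rintro x ⟨hx, rfl | rfl⟩
      · exact absurd hx h0
      · rfl

theorem isPerfectMatchingEdges_polyominoGraph_iff (M : Finset (Sym2 (PolyominoVertex n))) :
    IsPerfectMatchingEdges (polyominoGraph n) M ↔
      (M : Set (Sym2 (PolyominoVertex n))) ⊆ (polyominoGraph n).edgeSet ∧
      (HasEdge hn M (some (0, 0)) ↔ ¬ HasEdge hn M none) ∧
      (HasEdge hn M (some (0, 1)) ↔ ¬ HasEdge hn M none) ∧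
      ∀ i < n, IsLocalMatching fun k => HasEdge hn M (localLabel i k) := by
  rw [isPerfectMatchingEdges_iff]
  refine and_congr_right fun hM => ?_
  simp only [existsUnique_mem_iff hn hM]
  rw [← existsUnique_incident_zero _ (by simp) incident_zero_one,
    ← existsUnique_incident_zero _ (by simp) incident_zero_two]
  simp only [IsLocalMatching, ← existsUnique_incident_block]
  constructor
  · intro h
    have key : ∀ p, Admissible n p → ∃! x : Label, HasEdge hn M x ∧ x.Incident p := fun p hp => by
      simpa only [position_vertexAt hn hp] using h (vertexAt hn p)
    refine ⟨key _ ⟨Nat.succ_pos _, fun _ => Or.inl rfl⟩,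
      key _ ⟨Nat.succ_pos _, fun _ => Or.inr rfl⟩, fun i hi d r => key _ ⟨?_, fun h0 => ?_⟩⟩
    · have := d.isLt
      simp only
      omega
    · simp only at h0
      omega
  · rintro ⟨h1, h2, h3⟩ v
    obtain ⟨hc, hr⟩ := admissible_position v
    generalize position v = p at *
    obtain ⟨c, r⟩ := p
    simp only at hc hr
    rcases Nat.eq_zero_or_pos c with rfl | h0
    · rcases hr rfl with rfl | rfl
      · exact h1
      · exact h2
    · have := h3 ((c - 1) / 2) (by omega) ⟨(c - 1) % 2, by omega⟩ r
      rwa [show 2 * ((c - 1) / 2) + 1 + (c - 1) % 2 = c by omega] at this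

/-- The edges of the matching described by a chain of tiles. -/
def InChain (a : Bool) (w : Fin n → Tile) : Label → Prop
  | none => a = false
  | some (i, e) => ∃ h : i < n, e ∈ (w ⟨i, h⟩).support

theorem InChain.valid {a : Bool} {w : Fin n → Tile} : ∀ {x : Label}, InChain a w x → x.Valid n
  | none, _ => trivial
  | some (_, _), ⟨h, _⟩ => h

open Classical in
/-- The matching described by a chain of tiles. -/
noncomputable def chainMatching (a : Bool) (w : Fin n → Tile) :
    Finset (Sym2 (PolyominoVertex n)) :=
  Finset.univ.filter fun s => ∃ x, InChain a w x ∧ edge hn x = s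

theorem mem_chainMatching {a : Bool} {w : Fin n → Tile} {s : Sym2 (PolyominoVertex n)} :
    s ∈ chainMatching hn a w ↔ ∃ x, InChain a w x ∧ edge hn x = s := by
  simp [chainMatching]

theorem hasEdge_chainMatching {a : Bool} {w : Fin n → Tile} (x : Label) :
    HasEdge hn (chainMatching hn a w) x ↔ InChain a w x := by
  rw [HasEdge, mem_chainMatching]
  constructor
  · rintro ⟨hx, y, hy, h⟩
    rwa [← (edge_inj hn hy.valid hx).1 h]
  · exact fun h => ⟨h.valid, x, h, rfl⟩

theorem eq_of_hasEdge {M N : Finset (Sym2 (PolyominoVertex n))}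
    (hM : (M : Set (Sym2 (PolyominoVertex n))) ⊆ (polyominoGraph n).edgeSet)
    (hN : (N : Set (Sym2 (PolyominoVertex n))) ⊆ (polyominoGraph n).edgeSet)
    (h : ∀ x, HasEdge hn M x ↔ HasEdge hn N x) : M = N := by
  ext s
  constructor
  · intro hs
    obtain ⟨x, hx, rfl⟩ := (mem_edgeSet_iff hn s).1 (hM hs)
    exact ((h x).1 ⟨hx, hs⟩).2
  · intro hs
    obtain ⟨x, hx, rfl⟩ := (mem_edgeSet_iff hn s).1 (hN hs)
    exact ((h x).2 ⟨hx, hs⟩).2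

theorem chainMatching_subset (a : Bool) (w : Fin n → Tile) :
    (chainMatching hn a w : Set (Sym2 (PolyominoVertex n))) ⊆ (polyominoGraph n).edgeSet := by
  intro s hs
  obtain ⟨x, hx, rfl⟩ := (mem_chainMatching hn).1 hs
  exact (mem_edgeSet_iff hn _).2 ⟨x, hx.valid, rfl⟩

theorem localLabel_castLE (i : ℕ) : ∀ e : Fin 12,
    localLabel i (Fin.castLE (by decide) e) = some (i, e) := by
  intro e
  fin_cases e <;> rfl

theorem forall_fin_fourteen {P : Fin 14 → Prop}
    (h : ∀ e : Fin 12, P (Fin.castLE (by decide) e)) (h12 : P 12) (h13 : P 13) : ∀ k, P k := by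
  intro k
  by_cases hk : k.val < 12
  · exact h ⟨k, hk⟩
  · obtain rfl | rfl : k = 12 ∨ k = 13 := by omega
    · exact h12
    · exact h13

/-- Links 12 and 13 are stored in the next block, whose `src` equals the present `tgt`. After the
last block they do not exist, and there the chain ends with state `false`. -/
theorem inChain_localLabel {a : Bool} {w : Fin n → Tile} (hw : Chain n a w) (i : Fin n) :
    ∀ k, InChain a w (localLabel i k) ↔ k ∈ (w i).extendedSupport := by
  obtain ⟨σ, -, hσn, hσ⟩ := chain_iff.1 hw
  have key : ∀ e : Fin 12, (∀ m : Tile, e ∈ m.support ↔ m.src = true) →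
      (InChain a w (some ((i : ℕ) + 1, e)) ↔ (w i).tgt = true) := fun e he => by
    simp only [InChain, he, (hσ i).2]
    constructor
    · rintro ⟨h, h'⟩
      exact (hσ ⟨i + 1, h⟩).1 ▸ h'
    · intro h
      have hi : (i : ℕ) + 1 < n := by
        refine lt_of_le_of_ne i.isLt fun hin => ?_
        rw [hin, hσn] at h
        cases h
      exact ⟨hi, (hσ ⟨i + 1, hi⟩).1.trans h⟩
  refine forall_fin_fourteen (fun e => ?_) ?_ ?_
  · rw [localLabel_castLE, Tile.castLE_mem_extendedSupport]
    exact ⟨fun h => h.2, fun h => ⟨i.isLt, h⟩⟩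
  · rw [Tile.twelve_mem_extendedSupport]
    exact key 0 Tile.zero_mem_support
  · rw [Tile.thirteen_mem_extendedSupport]
    exact key 1 Tile.one_mem_support

theorem isPerfectMatchingEdges_chainMatching {a : Bool} {w : Fin n → Tile} (hw : Chain n a w) :
    IsPerfectMatchingEdges (polyominoGraph n) (chainMatching hn a w) := by
  rw [isPerfectMatchingEdges_polyominoGraph_iff hn]
  refine ⟨chainMatching_subset hn a w, ?_⟩
  simp only [hasEdge_chainMatching]
  obtain ⟨σ, hσ0, -, hσ⟩ := chain_iff.1 hw
  have h0 : (w ⟨0, hn⟩).src = a := (hσ ⟨0, hn⟩).1.trans hσ0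
  have key : ∀ e : Fin 12, (∀ m : Tile, e ∈ m.support ↔ m.src = true) →
      (InChain a w (some (0, e)) ↔ ¬ InChain a w none) := fun e he => by
    simp [InChain, he, h0, hn]
  refine ⟨key 0 Tile.zero_mem_support, key 1 Tile.one_mem_support, fun i hi => ?_⟩
  simp only [inChain_localLabel hw ⟨i, hi⟩]
  exact isLocalMatching_tile _

theorem exists_chainMatching_eq {M : Finset (Sym2 (PolyominoVertex n))}
    (hM : IsPerfectMatchingEdges (polyominoGraph n) M) :
    ∃ a w, Chain n a w ∧ chainMatching hn a w = M := by
  classical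
  obtain ⟨hsub, h0, h1, hloc⟩ := (isPerfectMatchingEdges_polyominoGraph_iff hn M).1 hM
  -- The two links of a pair agree: at column 0 both are opposite to `u_0 v_0`, and a tile passes
  -- the agreement from its left side to its right.
  have hlink : ∀ i, i ≤ n → (HasEdge hn M (some (i, 0)) ↔ HasEdge hn M (some (i, 1))) := by
    intro i
    induction i with
    | zero => exact fun _ => h0.trans h1.symm
    | succ i ih =>
      intro hi
      obtain ⟨m, hm⟩ := (hloc i hi).exists_tile (ih (Nat.le_of_succ_le hi))
      exact ((hm 12).trans ((Tile.twelve_mem_extendedSupport m).trans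
        (Tile.thirteen_mem_extendedSupport m).symm)).trans (hm 13).symm
  choose w hw using fun i : Fin n => (hloc i i.isLt).exists_tile (hlink i i.isLt.le)
  refine ⟨decide (HasEdge hn M (some (0, 0))), w, chain_iff.2
    ⟨fun i => decide (HasEdge hn M (some (i, 0))), rfl, ?_, fun i => ⟨?_, ?_⟩⟩,
    eq_of_hasEdge hn (chainMatching_subset hn _ _) hsub fun x => ?_⟩
  -- Block `n` does not exist, so its links are invalid labels and the final state is `false`.
  · exact decide_eq_false fun h => lt_irrefl n h.1
  · rw [Bool.eq_iff_iff, decide_eq_true_iff, ← Tile.zero_mem_support,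
      ← Tile.castLE_mem_extendedSupport]
    exact (hw i 0).symm
  · rw [Bool.eq_iff_iff, decide_eq_true_iff, ← Tile.twelve_mem_extendedSupport]
    exact (hw i 12).symm
  · rw [hasEdge_chainMatching]
    match x with
    | none =>
      simp only [InChain, decide_eq_false_iff_not, h0, not_not]
    | some (i, e) =>
      constructor
      · rintro ⟨hi, he⟩
        rw [← localLabel_castLE]
        exact (hw ⟨i, hi⟩ _).2 ((Tile.castLE_mem_extendedSupport _ _).2 he)
      · intro h
        refine ⟨h.1, ?_⟩
        rw [← localLabel_castLE] at h
        exact (Tile.castLE_mem_extendedSupport _ _).1 ((hw ⟨i, _⟩ _).1 h)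

theorem chainMatching_injective {a a' : Bool} {w w' : Fin n → Tile}
    (h : chainMatching hn a w = chainMatching hn a' w') : a = a' ∧ w = w' := by
  have key : ∀ x, InChain a w x ↔ InChain a' w' x := fun x => by
    rw [← hasEdge_chainMatching hn, h, hasEdge_chainMatching]
  constructor
  · have := key none
    simp only [InChain] at this
    revert this
    cases a <;> cases a' <;> simp
  · funext i
    refine Tile.support_injective (Finset.ext fun e => ?_)
    exact ⟨fun he => ((key (some (i, e))).1 ⟨i.isLt, he⟩).2,
      fun he => ((key (some (i, e))).2 ⟨i.isLt, he⟩).2⟩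

/-! ### Anti-forcing sets as families of block cuts. -/

open Classical in
/-- The edges of the block `i` that belong to `S`. -/
noncomputable def blockPart (S : Finset (Sym2 (PolyominoVertex n))) (i : Fin n) :
    Finset (Fin 12) :=
  Finset.univ.filter fun e => edge hn (some (i.val, e)) ∈ S

theorem disjoint_chainMatching_iff {a : Bool} {w : Fin n → Tile}
    {S : Finset (Sym2 (PolyominoVertex n))} :
    Disjoint (chainMatching hn a w) S ↔
      (a = false → edge hn none ∉ S) ∧ Avoids w (blockPart hn S) := by
  rw [Finset.disjoint_left]
  constructor
  · intro h
    refine ⟨fun ha => h ((mem_chainMatching hn).2 ⟨none, ha, rfl⟩), fun i => ?_⟩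
    rw [Finset.disjoint_left]
    exact fun e he hS => h ((mem_chainMatching hn).2 ⟨some (i, e), ⟨i.isLt, he⟩, rfl⟩)
      (Finset.mem_filter.1 hS).2
  · rintro ⟨h0, h⟩ s hs
    obtain ⟨x, hx, rfl⟩ := (mem_chainMatching hn).1 hs
    match x with
    | none => exact h0 hx
    | some (i, e) =>
      obtain ⟨hi, he⟩ := hx
      exact fun hS => Finset.disjoint_left.1 (h ⟨i, hi⟩) he
        (Finset.mem_filter.2 ⟨Finset.mem_univ _, hS⟩)

/-- The label of an edge that is given by a block number below `n`. -/
def liftLabel (y : Option (Fin n × Fin 12)) : Label := y.map fun p => (p.1.val, p.2)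

theorem liftLabel_valid : ∀ y : Option (Fin n × Fin 12), (liftLabel y).Valid n
  | none => trivial
  | some (i, _) => i.isLt

theorem liftLabel_injective : Function.Injective (liftLabel (n := n)) :=
  Option.map_injective fun p q h => by
    simp only [Prod.mk.injEq] at h
    exact Prod.ext (Fin.ext h.1) h.2

/-- The edges of `G_n`, by the number of the block. -/
noncomputable def edgeEmbedding : Option (Fin n × Fin 12) ↪ Sym2 (PolyominoVertex n) where
  toFun y := edge hn (liftLabel y)
  inj' _ _ h := liftLabel_injective ((edge_inj hn (liftLabel_valid _) (liftLabel_valid _)).1 h)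

open Classical in
theorem card_eq_sum_blockPart {S : Finset (Sym2 (PolyominoVertex n))}
    (hS : (S : Set (Sym2 (PolyominoVertex n))) ⊆ (polyominoGraph n).edgeSet) :
    S.card = (if edge hn none ∈ S then 1 else 0) + ∑ i, (blockPart hn S i).card := by
  have : S = (Finset.univ.filter fun y => edgeEmbedding hn y ∈ S).map (edgeEmbedding hn) := by
    ext s
    simp only [Finset.mem_map, Finset.mem_filter, Finset.mem_univ, true_and]
    constructor
    · intro hs
      obtain ⟨x, hx, rfl⟩ := (mem_edgeSet_iff hn s).1 (hS hs)
      match x with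
      | none => exact ⟨none, hs, rfl⟩
      | some (i, e) => exact ⟨some (⟨i, hx⟩, e), hs, rfl⟩
    · rintro ⟨y, hy, rfl⟩
      exact hy
  conv_lhs => rw [this]
  rw [Finset.card_map, Finset.card_filter, Fintype.sum_option, Fintype.sum_prod_type]
  simp only [blockPart, Finset.card_filter]
  rfl

theorem exists_blockPart_eq (b : Bool) (s : Fin n → Finset (Fin 12)) :
    ∃ S : Finset (Sym2 (PolyominoVertex n)),
      (S : Set (Sym2 (PolyominoVertex n))) ⊆ (polyominoGraph n).edgeSet ∧
      (edge hn none ∈ S ↔ b = true) ∧ blockPart hn S = s := by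
  classical
  let F : Finset (Option (Fin n × Fin 12)) :=
    Finset.univ.filter fun y => y.elim (b = true) fun p => p.2 ∈ s p.1
  have hF : ∀ y, edgeEmbedding hn y ∈ F.map (edgeEmbedding hn) ↔
      y.elim (b = true) fun p => p.2 ∈ s p.1 := fun y => by
    rw [Finset.mem_map', Finset.mem_filter, and_iff_right (Finset.mem_univ _)]
  refine ⟨F.map (edgeEmbedding hn), fun t ht => ?_, hF none, ?_⟩
  · obtain ⟨y, -, rfl⟩ := Finset.mem_map.1 ht
    exact (mem_edgeSet_iff hn _).2 ⟨_, liftLabel_valid y, rfl⟩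
  · funext i
    ext e
    rw [blockPart, Finset.mem_filter, and_iff_right (Finset.mem_univ _)]
    exact hF (some (i, e))

/-- Deleting `u_0 v_0` forces both links of the first block, so the left state may be taken as given
(`c = false`); otherwise the blocks must exclude both starts (`c = true`). -/
theorem isAntiForcingSet_chainMatching_iff {a : Bool} {w : Fin n → Tile} (hw : Chain n a w)
    {S : Finset (Sym2 (PolyominoVertex n))} :
    IsAntiForcingSet (polyominoGraph n) (chainMatching hn a w) S ↔
      (S : Set (Sym2 (PolyominoVertex n))) ⊆ (polyominoGraph n).edgeSet ∧
      (a = false → edge hn none ∉ S) ∧ Avoids w (blockPart hn S) ∧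
      ∃ c, (c = false → edge hn none ∈ S) ∧ Rigid c a w (blockPart hn S) := by
  rw [isAntiForcingSet_iff (isPerfectMatchingEdges_chainMatching hn hw),
    disjoint_chainMatching_iff, and_assoc]
  refine and_congr_right fun hS => and_congr_right fun ha => and_congr_right fun hA => ?_
  constructor
  · intro h
    by_cases hm : edge hn none ∈ S
    · refine ⟨false, fun _ => hm, fun b w' hb hw' hA' => ?_⟩
      obtain rfl : b = a := hb.resolve_right (by simp)
      exact (chainMatching_injective hn (h _ (isPerfectMatchingEdges_chainMatching hn hw')
        ((disjoint_chainMatching_iff hn).2 ⟨ha, hA'⟩))).2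
    · exact ⟨true, fun h => Bool.noConfusion h, fun b w' _ hw' hA' => (chainMatching_injective hn
        (h _ (isPerfectMatchingEdges_chainMatching hn hw')
          ((disjoint_chainMatching_iff hn).2 ⟨fun _ => hm, hA'⟩))).2⟩
  · rintro ⟨c, hc, hr⟩ N hN hd
    obtain ⟨b, w', hw', rfl⟩ := exists_chainMatching_eq hn hN
    obtain ⟨hb, hA'⟩ := (disjoint_chainMatching_iff hn).1 hd
    obtain rfl : w' = w := by
      refine hr b w' ?_ hw' hA'
      cases c
      · have hm := hc rfl
        refine Or.inl ?_
        cases a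
        · exact absurd hm (ha rfl)
        · cases b
          · exact absurd hm (hb rfl)
          · rfl
      · exact Or.inr rfl
    rw [hw'.context_unique hw]

/-- If `a` is false, `u_0 v_0` is in the matching and cannot be deleted, so the blocks force the
start. If `a` is true, deleting it costs 1, against the extra 3 of `minCut_gap`. -/
theorem antiForcingNumber_chainMatching {a : Bool} {w : Fin n → Tile} (hw : Chain n a w) :
    antiForcingNumber (polyominoGraph n) (chainMatching hn a w) =
      if a then minCut n w false + 1 else minCut n w true := by
  have hg := minCut_gap hw
  refine IsLeast.csInf_eq ⟨?_, ?_⟩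
  · obtain ⟨s, hs, hr, hc⟩ := exists_rigid (!a) hw
    obtain ⟨S, hS, h0, rfl⟩ := exists_blockPart_eq hn a s
    refine ⟨S, (isAntiForcingSet_chainMatching_iff hn hw).2 ⟨hS, fun h => ?_, hs, !a, ?_, hr⟩, ?_⟩
    · simp [h0, h]
    · simp [h0]
    · rw [card_eq_sum_blockPart hn hS, hc]
      cases a <;> simp [h0, add_comm]
  · rintro k ⟨S, hS, rfl⟩
    obtain ⟨hsub, h0, hA, c, hc, hr⟩ := (isAntiForcingSet_chainMatching_iff hn hw).1 hS
    have hle := minCut_le hw hA hr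
    rw [card_eq_sum_blockPart hn hsub]
    cases a <;> cases c <;> simp at h0 hc hg ⊢ <;> simp_all <;> omega

end Polyomino

/-! ### The polynomial of the graph and the recurrence. -/

theorem antiForcingPolynomial_of_isEmpty {V : Type*} [Fintype V] [IsEmpty V] (G : SimpleGraph V) :
    antiForcingPolynomial G = 1 := by
  have hM : IsPerfectMatchingEdges G ∅ :=
    isPerfectMatchingEdges_iff.2 ⟨by simp, fun v => isEmptyElim v⟩
  have h0 : antiForcingNumber G ∅ = 0 := Nat.le_zero.1 (Nat.sInf_le
    ⟨∅, (isAntiForcingSet_iff hM).2 ⟨by simp, by simp, fun N _ _ => Subsingleton.elim _ _⟩, rfl⟩)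
  classical
  rw [antiForcingPolynomial,
    Finset.sum_eq_single_of_mem ∅ (Finset.mem_filter.2 ⟨Finset.mem_univ _, hM⟩)
    fun N _ hN => absurd (Subsingleton.elim _ _) hN, h0, pow_zero]

theorem antiForcingPolynomial_polyominoGraph (n : ℕ) :
    antiForcingPolynomial (polyominoGraph n) =
      chainPolynomial n false (fun g => g true)
        + X * chainPolynomial n true (fun g => g false) := by
  classical
  rcases Nat.eq_zero_or_pos n with rfl | hn
  · have : IsEmpty (PolyominoVertex 0) := ⟨fun v => lt_irrefl 0 v.2.1⟩
    rw [antiForcingPolynomial_of_isEmpty, chainPolynomial_zero, chainPolynomial_zero]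
    simp
  · have key : antiForcingPolynomial (polyominoGraph n) =
        ∑ p : Bool × (Fin n → Tile) with Chain n p.1 p.2,
          (X : ℤ[X]) ^ if p.1 then minCut n p.2 false + 1 else minCut n p.2 true := by
      rw [antiForcingPolynomial]
      symm
      refine Finset.sum_bij (fun p _ => Polyomino.chainMatching hn p.1 p.2) ?_ ?_ ?_ ?_
      · intro p hp
        simp only [Finset.mem_filter, Finset.mem_univ, true_and] at hp ⊢
        exact Polyomino.isPerfectMatchingEdges_chainMatching hn hp
      · intro p _ q _ h
        obtain ⟨h1, h2⟩ := Polyomino.chainMatching_injective hn h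
        exact Prod.ext h1 h2
      · intro M hM
        simp only [Finset.mem_filter, Finset.mem_univ, true_and] at hM
        obtain ⟨a, w, hw, rfl⟩ := Polyomino.exists_chainMatching_eq hn hM
        exact ⟨(a, w), by simpa using hw, rfl⟩
      · intro p hp
        simp only [Finset.mem_filter, Finset.mem_univ, true_and] at hp
        rw [Polyomino.antiForcingNumber_chainMatching hn hp]
    rw [key, Finset.sum_filter, Fintype.sum_prod_type, Fintype.sum_bool, add_comm]
    simp only [chainPolynomial, Finset.sum_filter, Finset.mul_sum, pow_succ', mul_ite, mul_zero,
      if_true, Bool.false_eq_true, if_false]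

theorem theorem4p1 :
    (∀ n : ℕ, 3 ≤ n →
      antiForcingPolynomial (polyominoGraph n) =
        (3 * X ^ 3 + 3 * X ^ 2 + X) * antiForcingPolynomial (polyominoGraph (n - 1))
        - (2 * X ^ 6 + 6 * X ^ 5 - X ^ 4 + 3 * X ^ 3) *
            antiForcingPolynomial (polyominoGraph (n - 2))
        + (X ^ 7 + 3 * X ^ 6) * antiForcingPolynomial (polyominoGraph (n - 3))) ∧
    antiForcingPolynomial (polyominoGraph 0) = 1 ∧
    antiForcingPolynomial (polyominoGraph 1) = 2 * X ^ 3 + 3 * X ^ 2 + X ∧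
    antiForcingPolynomial (polyominoGraph 2) =
      4 * X ^ 6 + 9 * X ^ 5 + 15 * X ^ 4 + 3 * X ^ 3 + X ^ 2 := by
  simp only [antiForcingPolynomial_polyominoGraph]
  refine ⟨fun n hn => ?_, ?_, ?_, ?_⟩
  · obtain ⟨k, rfl⟩ : ∃ k, n = k + 3 := ⟨n - 3, by omega⟩
    rw [show k + 3 - 1 = k + 1 + 1 from rfl, show k + 3 - 2 = k + 1 from rfl,
      show k + 3 - 3 = k from rfl, show k + 3 = k + 1 + 1 + 1 from rfl]
    -- Everything is now expressed by the three polynomials at `k`; what remains is the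
    -- characteristic equation of the transfer matrix, with the stated coefficients as trace, sum of
    -- principal 2 × 2 minors and determinant.
    simp only [chainPolynomial_succ_false_false, chainPolynomial_succ_false_true,
      chainPolynomial_succ_true_false]
    ring
  · simp [chainPolynomial_zero]
  · change chainPolynomial (0 + 1) _ _ + X * chainPolynomial (0 + 1) _ _ = _
    simp only [chainPolynomial_succ_false_true, chainPolynomial_succ_true_false,
      chainPolynomial_zero, if_true, Bool.false_eq_true, if_false]
    ring
  · change chainPolynomial (0 + 1 + 1) _ _ + X * chainPolynomial (0 + 1 + 1) _ _ = _
    simp only [chainPolynomial_succ_false_false, chainPolynomial_succ_false_true,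
      chainPolynomial_succ_true_false, chainPolynomial_zero, if_true, Bool.false_eq_true, if_false]
    ring
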